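/- Let $d \ge 2$ and $0 < r < R$. Let $\bar\rho \in \mathcal{C}^0([0,R])$ be a probability density (that is, $\bar\rho \ge 0$ and $\int_0^R \bar\rho(t)\,dt = 1$) such that $\bar\rho = 0$ on $[0,r]$ and $\bar\rho$ is concave on $[r,R]$. Let $X = \{x \in \mathbb{R}^d : \|x\| \le R\}$ be the closed Euclidean ball and let $$\rho(x) = \frac{\bar\rho(\|x\|)}{\omega_{d-1}\,\|x\|^{d-1}} \quad (x \in X,\ x \neq 0), \qquad \rho(0) = 0,$$ where $\omega_{d-1}$ is the $(d-1)$-dimensional volume of the unit sphere $\mathbb{S}^{d-1}$. Then $\rho$ is a continuous probability density on $X$, its support (the closure of $\{x \in X : \rho(x) \neq 0\}$) is the annulus $\{x \in \mathbb{R}^d : r \le \|x\| \le R\}$, and $\rho$ satisfies a weighted $L^1$ Poincaré–Wirtinger inequality: there is a constant $C > 0$ such that for every function $f : X \to \mathbb{R}$ of class $\mathcal{C}^1$ on $X$, $$\int_X |f(x) - \mathbb{E}_\rho(f)|\,\rho(x)\,dx \le C \int_X \|\nabla f(x)\|\,\rho(x)\,dx, \qquad \mathbb{E}_\rho(f) =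 \int_X f(x)\rho(x)\,dx .$$ -/

import Mathlib

open MeasureTheory Metric Set

noncomputable section

/-- `ρ` is a continuous probability density on `X` with respect to the reference measure `volume`.
Only the values of `ρ` on `X` matter. -/
structure IsContinuousProbabilityDensity {E : Type*} [TopologicalSpace E] [MeasureSpace E]
    (X : Set E) (ρ : E → ℝ) : Prop where
  continuousOn : ContinuousOn ρ X
  nonneg : ∀ x ∈ X, 0 ≤ ρ x
  integral_eq_one : ∫ x in X, ρ x = 1

/-- The weighted norm `‖h‖_{L¹(ρ)} = ∫_X ‖h(x)‖ ρ(x) dx`. -/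
def weightedL1Norm {d : ℕ} {F : Type*} [NormedAddCommGroup F]
    (X : Set (EuclideanSpace ℝ (Fin d))) (ρ : EuclideanSpace ℝ (Fin d) → ℝ)
    (h : EuclideanSpace ℝ (Fin d) → F) : ℝ :=
  ∫ x in X, ‖h x‖ * ρ x

/-- The weighted mean `𝔼_ρ(f) = ∫_X f(x) ρ(x) dx`. -/
def weightedMean {d : ℕ}
    (X : Set (EuclideanSpace ℝ (Fin d))) (ρ f : EuclideanSpace ℝ (Fin d) → ℝ) : ℝ :=
  ∫ x in X, f x * ρ x

/-- The continuous probability density `ρ` on the compact set `X ⊆ ℝᵈ` satisfies the weighted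
`L¹` Poincaré–Wirtinger inequality with constant `C > 0`:
`‖f - 𝔼_ρ(f)‖_{L¹(ρ)} ≤ C ‖∇f‖_{L¹(ρ)}` for every function `f` of class `C¹` on `X`.
(`∇f` is the gradient relative to `X`; it is the usual gradient at interior points of `X`.) -/
structure SatisfiesPoincareWirtinger {d : ℕ}
    (X : Set (EuclideanSpace ℝ (Fin d))) (ρ : EuclideanSpace ℝ (Fin d) → ℝ) (C : ℝ) : Prop where
  isCompact : IsCompact X
  density : IsContinuousProbabilityDensity X ρ
  constant_pos : 0 < C
  inequality : ∀ f : EuclideanSpace ℝ (Fin d) → ℝ, ContDiffOn ℝ 1 f X →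
    weightedL1Norm X ρ (fun x => f x - weightedMean X ρ f) ≤
      C * weightedL1Norm X ρ (fun x => gradientWithin f X x)

/-- The surface volume `ω_{d-1}` of the unit sphere of `ℝᵈ`. -/
def unitSphereVolume (d : ℕ) : ℝ :=
  ((volume : Measure (EuclideanSpace ℝ (Fin d))).toSphere).real univ

/-- The radial function `ρ(x) = ρ̄(‖x‖) / (‖x‖^{d-1} ω_{d-1})` on `ℝᵈ`. -/
def radialDensity (d : ℕ) (ρbar : ℝ → ℝ) (x : EuclideanSpace ℝ (Fin d)) : ℝ :=
  ρbar ‖x‖ / (‖x‖ ^ (d - 1) * unitSphereVolume d)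

end

/-! Since `ρ` has mass one, `|f x - 𝔼 f| ≤ ∫ |f x - f y| ρ y dy`, so it suffices to bound the double
integral of `|f x - f y|` by the weighted norm of the gradient. In polar coordinates the factor `‖x‖
^ (d - 1)` cancels the Jacobian, and `ρ dx` becomes, up to `1 / ω`, the product of the surface
measure and `ρbar t dt`. The inequality then tensorises through `f (s θ) - f (t φ) = [f (s θ) - f (t
θ)] + [f (t θ) - f (t φ)]`.

Radial term (`lintegral_enorm_sub_le_of_weight`): bound the increment by the integral of the
derivative over `[s, t]` and exchange integrals. A point `u` is charged with the mass on its left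
times the mass on its right, at most a constant times `(u - r) (R - u)`. By concavity
(`ConcaveOn.mul_sub_mul_sub_le`) this is at most a constant times `ρbar u`.

Angular term (`exists_lintegral_toSphere_enorm_sub_le`): directions are represented by points `x`,
`y` of the unit ball and joined by projecting `cos a • x + sin a • y` to the sphere. The pair formed
by this point and its velocity is a rotation of `(x, y)`, which preserves the product measure. The
bound on the speed involves `1 / ‖x‖`, locally integrable because the dimension is at least two. -/

/-! ### Polar coordinates. -/

section Polar

open Module ENNReal

variable {E : Type*} [NormedAddCommGroup E] [NormedSpace ℝ E] [FiniteDimensional ℝ E]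
  [MeasurableSpace E] [BorelSpace E]

/-- Integration in polar coordinates. -/
theorem lintegral_eq_lintegral_toSphere [Nontrivial E] (μ : Measure E) [μ.IsAddHaarMeasure]
    {F : E → ℝ≥0∞} (hF : Measurable F) :
    ∫⁻ x, F x ∂μ = ∫⁻ θ, ∫⁻ t in Ioi (0 : ℝ),
      ENNReal.ofReal (t ^ (finrank ℝ E - 1)) * F (t • (θ : E)) ∂volume ∂μ.toSphere := by
  calc
    ∫⁻ x, F x ∂μ = ∫⁻ x : ({0}ᶜ : Set E), F x ∂(μ.comap (↑)) := by
      rw [lintegral_subtype_comap (measurableSet_singleton _).compl, restrict_compl_singleton]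
    _ = ∫⁻ p, F ((p.2 : ℝ) • (p.1 : E)) ∂μ.toSphere.prod (.volumeIoiPow (finrank ℝ E - 1)) := by
      rw [← μ.measurePreserving_homeomorphUnitSphereProd.lintegral_comp_emb
        (Homeomorph.measurableEmbedding _)]
      refine lintegral_congr fun x ↦ ?_
      congr 1
      have hx : ‖(x : E)‖ ≠ 0 := norm_ne_zero_iff.2 x.2
      simp [smul_smul, hx]
    _ = _ := by
      rw [lintegral_prod _ (by fun_prop)]
      refine lintegral_congr fun θ ↦ ?_
      rw [Measure.volumeIoiPow, lintegral_withDensity_eq_lintegral_mul _ (by fun_prop)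
        (by fun_prop)]
      exact lintegral_subtype_comap measurableSet_Ioi
        fun t : ℝ ↦ ENNReal.ofReal (t ^ (finrank ℝ E - 1)) * F (t • (θ : E))

/-- The integral of a radial function times a function of the angle. -/
theorem lintegral_norm_mul_comp_normalize [Nontrivial E] (μ : Measure E) [μ.IsAddHaarMeasure]
    {k : ℝ → ℝ≥0∞} (hk : Measurable k) {H : E → ℝ≥0∞} (hH : Measurable H) :
    ∫⁻ x, k ‖x‖ * H (‖x‖⁻¹ • x) ∂μ =
      (∫⁻ t in Ioi (0 : ℝ), ENNReal.ofReal (t ^ (finrank ℝ E - 1)) * k t) *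
        ∫⁻ θ, H θ ∂μ.toSphere := by
  rw [lintegral_eq_lintegral_toSphere μ (by fun_prop), ← lintegral_const_mul _ (by fun_prop)]
  refine lintegral_congr fun θ ↦ ?_
  rw [← lintegral_mul_const _ (by fun_prop)]
  refine setLIntegral_congr_fun measurableSet_Ioi fun t (ht : 0 < t) ↦ ?_
  have h1 : ‖t • (θ : E)‖ = t := by simp [norm_smul, abs_of_pos ht]
  simp only [h1, smul_smul, inv_mul_cancel₀ ht.ne', one_smul, mul_assoc]

end Polar

/-! ### Rotations of pairs of vectors. -/

section Rotation

open Module ENNReal Real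

variable {E : Type*} [NormedAddCommGroup E] [InnerProductSpace ℝ E]

/-- The cross terms cancel. The invariant is the Euclidean sum of squares, not the sup norm carried
by `E × E`. -/
theorem norm_sq_rotation (α : ℝ) (p : E × E) :
    ‖(ContinuousLinearMap.rotation α p).1‖ ^ 2 + ‖(ContinuousLinearMap.rotation α p).2‖ ^ 2 =
      ‖p.1‖ ^ 2 + ‖p.2‖ ^ 2 := by
  simp only [ContinuousLinearMap.rotation_apply, norm_add_sq_real, norm_smul, inner_smul_left,
    inner_smul_right, mul_pow, Real.norm_eq_abs, sq_abs, RCLike.conj_to_real]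
  linear_combination (‖p.1‖ ^ 2 + ‖p.2‖ ^ 2) * Real.sin_sq_add_cos_sq α

theorem rotation_neg_rotation (α : ℝ) (p : E × E) :
    ContinuousLinearMap.rotation (-α) (ContinuousLinearMap.rotation α p) = p := by
  have h := Real.sin_sq_add_cos_sq α
  ext
  · simp only [ContinuousLinearMap.rotation_apply, Real.cos_neg, Real.sin_neg]
    linear_combination (norm := module) h • p.1
  · simp only [ContinuousLinearMap.rotation_apply, Real.cos_neg, Real.sin_neg]
    linear_combination (norm := module) h • p.2

variable [FiniteDimensional ℝ E] [MeasurableSpace E] [BorelSpace E]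

/-- Rotations of `E × E` preserve the product Haar measure. -/
theorem measurePreserving_rotation (μ : Measure E) [μ.IsAddHaarMeasure] (α : ℝ) :
    MeasurePreserving (ContinuousLinearMap.rotation α : E × E → E × E) (μ.prod μ) (μ.prod μ) := by
  have hcont := (ContinuousLinearMap.rotation α : E × E →L[ℝ] E × E).continuous
  refine ⟨hcont.measurable, ?_⟩
  let L : E × E →ₗ[ℝ] E × E := (ContinuousLinearMap.rotation α : E × E →L[ℝ] E × E)
  have hinj : Function.Injective L := fun p q hpq ↦ by
    have := congrArg (ContinuousLinearMap.rotation (-α)) (show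
      ContinuousLinearMap.rotation α p = ContinuousLinearMap.rotation α q from hpq)
    simpa [rotation_neg_rotation] using this
  have hdet : LinearMap.det L ≠ 0 := by
    have := (LinearEquiv.ofInjectiveEndo L hinj).isUnit_det'
    exact this.ne_zero
  have hmap := Measure.map_linearMap_addHaar_eq_smul_addHaar (μ.prod μ) hdet
  -- A bounded open set invariant under the rotation has positive finite measure, which forces the
  -- determinant factor to be 1.
  let A : Set (E × E) := {p | ‖p.1‖ ^ 2 + ‖p.2‖ ^ 2 < 1}
  have hA : IsOpen A := isOpen_lt (by fun_prop) continuous_const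
  have hpre : L ⁻¹' A = A := by
    ext p
    change ‖(ContinuousLinearMap.rotation α p).1‖ ^ 2 +
      ‖(ContinuousLinearMap.rotation α p).2‖ ^ 2 < 1 ↔ ‖p.1‖ ^ 2 + ‖p.2‖ ^ 2 < 1
    rw [norm_sq_rotation]
  have hA0 : μ.prod μ A ≠ 0 := hA.measure_ne_zero _ ⟨0, by simp [A]⟩
  have hAtop : μ.prod μ A ≠ ⊤ := by
    refine ((measure_mono (t := closedBall 0 1) fun p hp ↦ ?_).trans_lt
      (isCompact_closedBall _ _).measure_lt_top).ne
    have hp' : ‖p.1‖ ^ 2 + ‖p.2‖ ^ 2 < 1 := hp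
    rw [mem_closedBall_zero_iff, Prod.norm_def]
    refine max_le ?_ ?_
    · nlinarith [sq_nonneg ‖p.2‖, norm_nonneg p.1]
    · nlinarith [sq_nonneg ‖p.1‖, norm_nonneg p.2]
  have key : ENNReal.ofReal |(LinearMap.det L)⁻¹| = 1 := by
    have h1 := congrArg (fun m : Measure (E × E) ↦ m A) hmap
    simp only [Measure.smul_apply, smul_eq_mul] at h1
    rw [Measure.map_apply (show Measurable L from hcont.measurable) hA.measurableSet,
      hpre] at h1
    have := ENNReal.mul_left_inj hA0 hAtop |>.1 ((one_mul _).trans h1)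
    exact this.symm
  rw [key, one_smul] at hmap
  exact hmap

end Rotation

/-! ### Poincaré inequality on spheres. -/

section SpherePoincare

open Module ENNReal Real

variable {E : Type*} [NormedAddCommGroup E] [InnerProductSpace ℝ E]

/-- Differentiating `‖X‖⁻¹` and differentiating `X` each contribute at most `‖X'‖ / ‖X‖`. The factor
2 is not sharp, but any constant will do. -/
theorem exists_hasDerivAt_normalize {X : ℝ → E} {X' : E} {a : ℝ} (hX : HasDerivAt X X' a)
    (h0 : X a ≠ 0) :
    ∃ v, HasDerivAt (fun b ↦ ‖X b‖⁻¹ • X b) v a ∧ ‖v‖ ≤ 2 * ‖X'‖ / ‖X a‖ := by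
  have hn : 0 < ‖X a‖ := norm_pos_iff.2 h0
  have h1 := hX.norm_sq.sqrt (by positivity)
  simp only [Real.sqrt_sq (norm_nonneg _)] at h1
  refine ⟨_, (h1.inv hn.ne').smul hX, ?_⟩
  refine (norm_add_le _ _).trans ?_
  have h2 : |inner ℝ (X a) X'| ≤ ‖X a‖ * ‖X'‖ := abs_real_inner_le_norm _ _
  simp only [norm_smul, norm_inv, Pi.inv_apply, norm_div, norm_neg, norm_mul, Real.norm_eq_abs,
    abs_two, norm_pow, abs_norm]
  have h3 : 2 * |inner ℝ (X a) X'| / (2 * ‖X a‖) / ‖X a‖ ^ 2 * ‖X a‖ ≤ ‖X'‖ / ‖X a‖ := by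
    rw [show 2 * |inner ℝ (X a) X'| / (2 * ‖X a‖) / ‖X a‖ ^ 2 * ‖X a‖ =
      |inner ℝ (X a) X'| / ‖X a‖ / ‖X a‖ by field_simp]
    gcongr
    rw [div_le_iff₀ hn]
    linarith
  calc _ ≤ ‖X a‖⁻¹ * ‖X'‖ + ‖X'‖ / ‖X a‖ := by gcongr
    _ = _ := by ring

/-- The increment of `f` between two points of the sphere of radius `t` is bounded by an integral
along the radial projection of the arc `a ↦ cos a • x + sin a • y`. -/
theorem enorm_sub_le_lintegral_rotation {R t : ℝ} (ht : t ∈ Ioo 0 R) {f : E → ℝ}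
    (hf : ContDiffOn ℝ 1 f (ball 0 R)) {x y : E}
    (hxy : ∀ a : ℝ, cos a • x + sin a • y ≠ 0) :
    ‖f (t • ‖y‖⁻¹ • y) - f (t • ‖x‖⁻¹ • x)‖ₑ ≤ ∫⁻ a in Icc 0 (π / 2),
      ENNReal.ofReal (2 * t * ‖(ContinuousLinearMap.rotation a (x, y)).2‖ /
        ‖(ContinuousLinearMap.rotation a (x, y)).1‖) *
      ‖fderiv ℝ f (t • ‖(ContinuousLinearMap.rotation a (x, y)).1‖⁻¹ •
        (ContinuousLinearMap.rotation a (x, y)).1)‖ₑ := by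
  simp only [ContinuousLinearMap.rotation_apply]
  set X : ℝ → E := fun a ↦ cos a • x + sin a • y with hXdef
  set g : ℝ → ℝ := fun a ↦ f (t • ‖X a‖⁻¹ • X a) with hg
  -- The velocity of the arc is the second component of the rotated pair.
  have hX : ∀ a, HasDerivAt X (-sin a • x + cos a • y) a := fun a ↦
    ((hasDerivAt_cos a).smul_const x).add ((hasDerivAt_sin a).smul_const y)
  have hXc : ContDiff ℝ 1 X := by fun_prop
  have hmem : ∀ a, t • ‖X a‖⁻¹ • X a ∈ ball (0 : E) R := fun a ↦ by
    have : ‖X a‖ ≠ 0 := norm_ne_zero_iff.2 (hxy a)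
    simpa [norm_smul, this, abs_of_pos ht.1] using ht.2
  have hγ : ContDiff ℝ 1 fun a ↦ t • ‖X a‖⁻¹ • X a :=
    contDiff_const.smul (((hXc.norm ℝ hxy).inv fun a ↦ norm_ne_zero_iff.2 (hxy a)).smul hXc)
  have hgc : ContDiffOn ℝ 1 g (Icc 0 (π / 2)) :=
    hf.comp hγ.contDiffOn fun a _ ↦ hmem a
  have h := enorm_sub_le_lintegral_deriv_of_contDiffOn_Icc hgc (by positivity)
  have e0 : g 0 = f (t • ‖x‖⁻¹ • x) := by simp [hg, hXdef]
  have e1 : g (π / 2) = f (t • ‖y‖⁻¹ • y) := by simp [hg, hXdef]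
  rw [e0, e1] at h
  refine h.trans (lintegral_mono fun a ↦ ?_)
  obtain ⟨v, hv, hvn⟩ := exists_hasDerivAt_normalize (hX a) (hxy a)
  have hd : DifferentiableAt ℝ f (t • ‖X a‖⁻¹ • X a) :=
    (hf.differentiableOn one_ne_zero).differentiableAt (isOpen_ball.mem_nhds (hmem a))
  have hga : HasDerivAt g (fderiv ℝ f (t • ‖X a‖⁻¹ • X a) (t • v)) a :=
    hd.hasFDerivAt.comp_hasDerivAt a (hv.const_smul t)
  change ‖deriv g a‖ₑ ≤ _
  rw [hga.deriv, mul_comm]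
  refine (ContinuousLinearMap.le_opENorm _ _).trans ?_
  gcongr
  rw [← ofReal_norm]
  refine ENNReal.ofReal_le_ofReal ?_
  rw [norm_smul, Real.norm_eq_abs, abs_of_pos ht.1]
  calc t * ‖v‖ ≤ t * (2 * ‖-sin a • x + cos a • y‖ / ‖X a‖) := by
        gcongr; exact ht.1.le
    _ = _ := by ring

variable [FiniteDimensional ℝ E] [MeasurableSpace E] [BorelSpace E]

/-- If the arc meets the origin, then `y` lies on the line through `x`, which is null in dimension
at least two. -/
theorem ae_cos_smul_add_sin_smul_ne_zero (hE : 2 ≤ finrank ℝ E) (μ : Measure E)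
    [μ.IsAddHaarMeasure] {x : E} (hx : x ≠ 0) :
    ∀ᵐ y ∂μ, ∀ a : ℝ, cos a • x + sin a • y ≠ 0 := by
  have hspan : Submodule.span ℝ {x} ≠ ⊤ := by
    intro h
    have h1 := finrank_span_singleton (K := ℝ) hx
    rw [h, finrank_top] at h1
    omega
  have h0 := Measure.addHaar_submodule μ (Submodule.span ℝ {x}) hspan
  filter_upwards [measure_eq_zero_iff_ae_notMem.1 h0] with y hy a ha
  by_cases hs : sin a = 0
  · have hc : cos a ≠ 0 := fun hc ↦ by
      have := sin_sq_add_cos_sq a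
      simp [hs, hc] at this
    simp [hs, hc, hx] at ha
  · refine hy ?_
    rw [SetLike.mem_coe, Submodule.mem_span_singleton]
    refine ⟨-(sin a)⁻¹ * cos a, ?_⟩
    have h2 := congrArg (fun z ↦ (sin a)⁻¹ • z) ha
    simp only [smul_add, smul_smul, inv_mul_cancel₀ hs, one_smul, smul_zero] at h2
    rw [neg_mul, neg_smul, neg_eq_iff_add_eq_zero, h2]

/-- The `L¹` Poincaré inequality on the spheres of radius less than `R`, in its two-point form. -/
theorem exists_lintegral_toSphere_enorm_sub_le (hE : 2 ≤ finrank ℝ E) (μ : Measure E)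
    [μ.IsAddHaarMeasure] (R : ℝ) :
    ∃ K : ℝ≥0∞, K ≠ ⊤ ∧ ∀ f : E → ℝ, Measurable f → ContDiffOn ℝ 1 f (ball 0 R) →
      ∀ t ∈ Ioo 0 R, ∫⁻ θ, ∫⁻ φ, ‖f (t • (θ : E)) - f (t • (φ : E))‖ₑ ∂μ.toSphere ∂μ.toSphere ≤
        K * ∫⁻ θ, ‖fderiv ℝ f (t • (θ : E))‖ₑ ∂μ.toSphere := by
  have : Nontrivial E := Module.nontrivial_of_finrank_pos (R := ℝ) (by omega)
  let n := finrank ℝ E - 1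
  -- `k₁` restricts `x` and `y` to the unit ball. `k₂` dominates the speed of the projected arc: `2
  -- * t * ‖p.2‖ ≤ 4 * R` when `t < R` and `‖p.2‖ ≤ 2`.
  let k₁ : ℝ → ℝ≥0∞ := (Iio 1).indicator 1
  let k₂ : ℝ → ℝ≥0∞ := (Iic 2).indicator fun s ↦ ENNReal.ofReal (4 * R / s)
  have hk₁ : Measurable k₁ := measurable_one.indicator measurableSet_Iio
  have hk₂ : Measurable k₂ := Measurable.indicator (by fun_prop) measurableSet_Iic
  let c₁ := ∫⁻ s in Ioi (0 : ℝ), ENNReal.ofReal (s ^ n) * k₁ s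
  let c₂ := ∫⁻ s in Ioi (0 : ℝ), ENNReal.ofReal (s ^ n) * k₂ s
  have hσ0 : μ.toSphere univ ≠ 0 := by
    rw [Ne, Measure.measure_univ_eq_zero]
    exact μ.toSphere_ne_zero
  have hc₁ : c₁ * μ.toSphere univ = μ (ball 0 1) := by
    have h := lintegral_norm_mul_comp_normalize μ hk₁ (H := 1) measurable_one
    simp only [Pi.one_apply, mul_one, lintegral_one] at h
    rw [← h, ← lintegral_indicator_one measurableSet_ball]
    refine lintegral_congr fun x ↦ ?_
    simp [k₁, indicator]
  have hc₁0 : c₁ ≠ 0 := fun h ↦ by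
    rw [h, zero_mul] at hc₁
    exact (measure_ball_pos μ (0 : E) one_pos).ne hc₁
  have hc₁top : c₁ ≠ ⊤ := fun h ↦ by
    rw [h, ENNReal.top_mul hσ0] at hc₁
    exact measure_ball_lt_top.ne hc₁.symm
  have hc₂top : c₂ ≠ ⊤ := by
    have hle : c₂ ≤ ∫⁻ s in Ioc (0 : ℝ) 2, ENNReal.ofReal (2 ^ (n - 1) * (4 * |R|)) := by
      simp only [c₂]
      rw [← lintegral_indicator measurableSet_Ioi, ← lintegral_indicator measurableSet_Ioc]
      refine lintegral_mono fun s ↦ ?_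
      by_cases hs : 0 < s
      · by_cases hs2 : s ≤ 2
        · simp only [k₂, indicator, mem_Ioi, hs, hs2, mem_Iic, mem_Ioc, and_self, if_true]
          rw [← ENNReal.ofReal_mul (by positivity)]
          refine ENNReal.ofReal_le_ofReal ?_
          -- Dimension at least two enters here: the Jacobian `s ^ n` with `1 ≤ n` absorbs the
          -- singularity `1 / s`.
          have hn : n = (n - 1) + 1 := by omega
          calc s ^ n * (4 * R / s) = s ^ (n - 1) * (4 * R) := by
                rw [hn, pow_succ, Nat.add_sub_cancel]; field_simp
            _ ≤ 2 ^ (n - 1) * (4 * |R|) := by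
                refine (mul_le_mul_of_nonneg_left (b := 4 * R) (c := 4 * |R|) ?_
                  (by positivity)).trans ?_
                · linarith [le_abs_self R]
                · gcongr
        · simp [k₂, indicator, hs2]
      · simp [indicator, hs]
    refine (hle.trans_lt ?_).ne
    rw [setLIntegral_const]
    exact ENNReal.mul_lt_top ENNReal.ofReal_lt_top (by simp)
  -- Each `c₁⁻¹` undoes the radial integration of one of the two points, `π / 2` is the range of the
  -- angle, and the last product comes from integrating the two rotated components separately.
  refine ⟨c₁⁻¹ * c₁⁻¹ * (ENNReal.ofReal (π / 2) * (c₂ * μ (closedBall 0 2))), ?_, ?_⟩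
  · have := (isCompact_closedBall (0 : E) 2).measure_lt_top (μ := μ) |>.ne
    have := ENNReal.inv_ne_top.2 hc₁0
    finiteness
  intro f hfm hf t ht
  let H : E → E → ℝ≥0∞ := fun x y ↦ ‖f (t • x) - f (t • y)‖ₑ
  let G : E → ℝ≥0∞ := fun x ↦ ‖fderiv ℝ f (t • x)‖ₑ
  have hdf : Measurable (fderiv ℝ f) := measurable_fderiv ℝ f
  have hG : Measurable G := by fun_prop
  have hH : Measurable fun p : E × E ↦ H p.1 p.2 := by fun_prop
  let A : Set (E × E) := {p | ‖p.1‖ ^ 2 + ‖p.2‖ ^ 2 ≤ 2}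
  have hA : MeasurableSet A := measurableSet_le (by fun_prop) measurable_const
  -- The truncation to `A` is rotation invariant and contains every pair of points of the unit ball.
  let Ψ : E × E → ℝ≥0∞ := A.indicator fun p ↦
    ENNReal.ofReal (2 * t * ‖p.2‖ / ‖p.1‖) * G (‖p.1‖⁻¹ • p.1)
  have hΨ : Measurable Ψ := Measurable.indicator (by fun_prop) hA
  have hlower : ∫⁻ x, ∫⁻ y, k₁ ‖x‖ * (k₁ ‖y‖ * H (‖x‖⁻¹ • x) (‖y‖⁻¹ • y)) ∂μ ∂μ =
      c₁ * (c₁ * ∫⁻ θ, ∫⁻ φ, H θ φ ∂μ.toSphere ∂μ.toSphere) := by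
    have h1 : ∀ x : E, ∫⁻ y, k₁ ‖x‖ * (k₁ ‖y‖ * H (‖x‖⁻¹ • x) (‖y‖⁻¹ • y)) ∂μ =
        k₁ ‖x‖ * (c₁ * ∫⁻ φ, H (‖x‖⁻¹ • x) φ ∂μ.toSphere) := fun x ↦ by
      rw [lintegral_const_mul _ (by fun_prop),
        lintegral_norm_mul_comp_normalize μ hk₁ (H := H (‖x‖⁻¹ • x)) (by fun_prop)]
    simp_rw [h1]
    have hm : Measurable fun x : E ↦ ∫⁻ φ, H x φ ∂μ.toSphere :=
      Measurable.lintegral_prod_right' (f := fun p : E × sphere (0 : E) 1 ↦ H p.1 p.2)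
        (by fun_prop)
    rw [lintegral_norm_mul_comp_normalize μ hk₁
      (H := fun x ↦ c₁ * ∫⁻ φ, H x φ ∂μ.toSphere) (by fun_prop)]
    rw [lintegral_const_mul c₁ (f := fun θ : sphere (0 : E) 1 ↦ ∫⁻ φ, H θ φ ∂μ.toSphere)
      (hm.comp measurable_subtype_coe)]
  have hpt : ∀ᵐ x ∂μ, ∀ᵐ y ∂μ, k₁ ‖x‖ * (k₁ ‖y‖ * H (‖x‖⁻¹ • x) (‖y‖⁻¹ • y)) ≤
      ∫⁻ a in Icc 0 (π / 2), Ψ (ContinuousLinearMap.rotation a (x, y)) := by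
    filter_upwards [Measure.ae_ne μ (0 : E)] with x hx
    filter_upwards [ae_cos_smul_add_sin_smul_ne_zero hE μ hx] with y hy
    by_cases hx1 : ‖x‖ < 1
    · by_cases hy1 : ‖y‖ < 1
      · have hmem : ∀ a, ContinuousLinearMap.rotation a (x, y) ∈ A := fun a ↦ by
          change _ ≤ (2 : ℝ)
          rw [norm_sq_rotation]
          nlinarith [norm_nonneg x, norm_nonneg y]
        simp only [k₁, indicator, mem_Iio, hx1, hy1, if_true, Pi.one_apply, one_mul, Ψ, hmem]
        rw [show H (‖x‖⁻¹ • x) (‖y‖⁻¹ • y) = ‖f (t • ‖y‖⁻¹ • y) - f (t • ‖x‖⁻¹ • x)‖ₑ from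
          enorm_sub_rev _ _]
        exact enorm_sub_le_lintegral_rotation ht hf hy
      · simp [k₁, indicator, hy1]
    · simp [k₁, indicator, hx1]
  have hrot : Measurable fun q : (E × E) × ℝ ↦ ContinuousLinearMap.rotation q.2 q.1 := by
    simp only [ContinuousLinearMap.rotation_apply]
    fun_prop
  have hmid : ∫⁻ x, ∫⁻ y, ∫⁻ a in Icc 0 (π / 2),
      Ψ (ContinuousLinearMap.rotation a (x, y)) ∂volume ∂μ ∂μ =
      ENNReal.ofReal (π / 2) * ∫⁻ p, Ψ p ∂μ.prod μ := by
    have hm : Measurable fun q : (E × E) × ℝ ↦ Ψ (ContinuousLinearMap.rotation q.2 q.1) :=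
      hΨ.comp hrot
    rw [← lintegral_prod (fun p ↦ ∫⁻ a in Icc 0 (π / 2),
      Ψ (ContinuousLinearMap.rotation a p)) hm.lintegral_prod_right'.aemeasurable,
      lintegral_lintegral_swap hm.aemeasurable]
    -- By invariance the inner integral does not depend on the angle.
    simp_rw [fun a ↦ (measurePreserving_rotation μ a).lintegral_comp hΨ]
    rw [setLIntegral_const, mul_comm]
    simp
  have hupper : ∫⁻ p, Ψ p ∂μ.prod μ ≤
      c₂ * μ (closedBall 0 2) * ∫⁻ θ, G θ ∂μ.toSphere := by
    calc ∫⁻ p, Ψ p ∂μ.prod μ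
        ≤ ∫⁻ p, (k₂ ‖p.1‖ * G (‖p.1‖⁻¹ • p.1)) *
          (closedBall (0 : E) 2).indicator 1 p.2 ∂μ.prod μ := by
          refine lintegral_mono fun p ↦ ?_
          by_cases hp : p ∈ A
          swap
          · simp [Ψ, indicator_of_notMem hp]
          have hp' : ‖p.1‖ ^ 2 + ‖p.2‖ ^ 2 ≤ 2 := hp
          simp only [Ψ, indicator_of_mem hp]
          have h1 : ‖p.1‖ ≤ 2 := by nlinarith [sq_nonneg ‖p.2‖, norm_nonneg p.1]
          have h2 : ‖p.2‖ ≤ 2 := by nlinarith [sq_nonneg ‖p.1‖, norm_nonneg p.2]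
          simp only [k₂, indicator, mem_Iic, h1, mem_closedBall_zero_iff, h2, if_true,
            Pi.one_apply, mul_one]
          gcongr ENNReal.ofReal (?_ / _) * _
          nlinarith [ht.1, ht.2, norm_nonneg p.2]
      _ = (∫⁻ x, k₂ ‖x‖ * G (‖x‖⁻¹ • x) ∂μ) * ∫⁻ y, (closedBall (0 : E) 2).indicator 1 y ∂μ :=
          lintegral_prod_mul (f := fun x : E ↦ k₂ ‖x‖ * G (‖x‖⁻¹ • x)) (by fun_prop)
            (measurable_one.indicator measurableSet_closedBall).aemeasurable
      _ = _ := by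
          rw [lintegral_norm_mul_comp_normalize μ hk₂ hG,
            lintegral_indicator_one measurableSet_closedBall]
          ring
  have hmain : c₁ * (c₁ * ∫⁻ θ, ∫⁻ φ, H θ φ ∂μ.toSphere ∂μ.toSphere) ≤
      ENNReal.ofReal (π / 2) * (c₂ * μ (closedBall 0 2) * ∫⁻ θ, G θ ∂μ.toSphere) := by
    rw [← hlower]
    calc _ ≤ _ := lintegral_mono_ae (hpt.mono fun x hx ↦ lintegral_mono_ae hx)
      _ = _ := hmid
      _ ≤ _ := by gcongr
  calc ∫⁻ θ, ∫⁻ φ, H θ φ ∂μ.toSphere ∂μ.toSphere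
      = c₁⁻¹ * (c₁⁻¹ * (c₁ * (c₁ * ∫⁻ θ, ∫⁻ φ, H θ φ ∂μ.toSphere ∂μ.toSphere))) := by
        rw [ENNReal.inv_mul_cancel_left hc₁0 hc₁top, ENNReal.inv_mul_cancel_left hc₁0 hc₁top]
    _ ≤ c₁⁻¹ * (c₁⁻¹ * (ENNReal.ofReal (π / 2) *
          (c₂ * μ (closedBall 0 2) * ∫⁻ θ, G θ ∂μ.toSphere))) := by gcongr
    _ = _ := by ring

end SpherePoincare

/-! ### Weighted Poincaré inequality on an interval. -/

section RadialPoincare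

open ENNReal

/-- A two-point `L¹` Poincaré inequality on an interval, for a bounded weight that dominates the
product of the distances to the end points. -/
theorem lintegral_enorm_sub_le_of_weight {r R : ℝ} {w : ℝ → ℝ≥0∞} (hw : Measurable w)
    (hw0 : ∀ u ∉ Ioo r R, w u = 0) {M K : ℝ≥0∞} (hM : ∀ u, w u ≤ M)
    (hK : ∀ u ∈ Ioo r R, ENNReal.ofReal (u - r) * ENNReal.ofReal (R - u) ≤ K * w u)
    {g : ℝ → ℝ} (hg : ContDiffOn ℝ 1 g (Ioo r R)) :
    ∫⁻ s, ∫⁻ t, ‖g s - g t‖ₑ ∂volume.withDensity w ∂volume.withDensity w ≤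
      2 * (M * M * K) * ∫⁻ u, ‖deriv g u‖ₑ ∂volume.withDensity w := by
  set l : Measure ℝ := volume.withDensity w with hl
  have hD : Measurable fun u ↦ ‖deriv g u‖ₑ := (measurable_deriv g).enorm
  have hae : ∀ᵐ s ∂l, s ∈ Ioo r R := by
    rw [ae_withDensity_iff hw]
    exact .of_forall fun u hu ↦ by_contra fun h ↦ hu (hw0 u h)
  have hset : ∀ (S T : Set ℝ), MeasurableSet S → (∀ u ∈ S, u ∈ Ioo r R → u ∈ T) →
      l S ≤ M * volume T := fun S T hS hST ↦ by
    rw [hl, withDensity_apply _ hS, ← lintegral_indicator hS]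
    calc _ ≤ ∫⁻ u, T.indicator (fun _ ↦ M) u := by
          refine lintegral_mono fun u ↦ ?_
          by_cases hu : u ∈ S
          · by_cases hu' : u ∈ Ioo r R
            · simp [indicator, hu, hST u hu hu', hM]
            · simp [indicator, hw0 u hu']
          · simp [indicator, hu]
      _ ≤ _ := lintegral_indicator_const_le _ _
  have hIic : ∀ u, l (Iic u) ≤ M * ENNReal.ofReal (u - r) := fun u ↦
    (hset _ (Icc r u) measurableSet_Iic fun v hv hv' ↦ ⟨hv'.1.le, hv⟩).trans_eq (by simp)
  have hIci : ∀ u, l (Ici u) ≤ M * ENNReal.ofReal (R - u) := fun u ↦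
    (hset _ (Icc u R) measurableSet_Ici fun v hv hv' ↦ ⟨hv, hv'.2.le⟩).trans_eq (by simp)
  have hSF : SFinite l := by rw [hl]; infer_instance
  let I : Set ((ℝ × ℝ) × ℝ) := {q | q.1.1 ≤ q.2 ∧ q.2 ≤ q.1.2}
  have hI : MeasurableSet I :=
    (measurableSet_le (measurable_fst.comp measurable_fst) measurable_snd).inter
      (measurableSet_le measurable_snd (measurable_snd.comp measurable_fst))
  let N : ℝ → ℝ → ℝ → ℝ≥0∞ := fun s t u ↦ I.indicator (fun q ↦ ‖deriv g q.2‖ₑ) ((s, t), u)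
  have hN : Measurable fun q : (ℝ × ℝ) × ℝ ↦ N q.1.1 q.1.2 q.2 :=
    Measurable.indicator (by fun_prop) hI
  have hle : ∀ s ∈ Ioo r R, ∀ t ∈ Ioo r R, s ≤ t → ‖g s - g t‖ₑ ≤ ∫⁻ u, N s t u := by
    intro s hs t ht hst
    have hsub : Icc s t ⊆ Ioo r R := Icc_subset_Ioo hs.1 ht.2
    rw [enorm_sub_rev]
    refine (enorm_sub_le_lintegral_deriv_of_contDiffOn_Icc (hg.mono hsub) hst).trans_eq ?_
    rw [← lintegral_indicator measurableSet_Icc]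
    rfl
  have hle' : ∀ s ∈ Ioo r R, ∀ t ∈ Ioo r R,
      ‖g s - g t‖ₑ ≤ (∫⁻ u, N s t u) + ∫⁻ u, N t s u := by
    intro s hs t ht
    rcases le_total s t with h | h
    · exact (hle s hs t ht h).trans le_self_add
    · rw [enorm_sub_rev]
      exact (hle t ht s hs h).trans le_add_self
  have hNm : Measurable fun p : ℝ × ℝ ↦ ∫⁻ u, N p.1 p.2 u := hN.lintegral_prod_right'
  have hJ : ∫⁻ s, ∫⁻ t, ∫⁻ u, N s t u ∂volume ∂l ∂l ≤ M * M * K * ∫⁻ u, ‖deriv g u‖ₑ ∂l := by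
    -- For fixed `u`, the pairs with `s ≤ u ≤ t` form the rectangle `Iic u ×ˢ Ici u`, so their mass
    -- factors.
    have hinner : ∀ u, ∫⁻ p, N p.1 p.2 u ∂l.prod l = ‖deriv g u‖ₑ * (l (Iic u) * l (Ici u)) := by
      intro u
      rw [← Measure.prod_prod, ← lintegral_indicator_const
        (measurableSet_Iic.prod measurableSet_Ici)]
      rfl
    rw [← lintegral_prod (fun p : ℝ × ℝ ↦ ∫⁻ u, N p.1 p.2 u) hNm.aemeasurable,
      lintegral_lintegral_swap hN.aemeasurable]
    simp_rw [hinner]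
    rw [hl, lintegral_withDensity_eq_lintegral_mul _ hw hD, ← hl,
      ← lintegral_const_mul _ (by fun_prop)]
    refine lintegral_mono fun u ↦ ?_
    calc ‖deriv g u‖ₑ * (l (Iic u) * l (Ici u))
        ≤ ‖deriv g u‖ₑ * ((M * ENNReal.ofReal (u - r)) * (M * ENNReal.ofReal (R - u))) := by
          gcongr
          · exact hIic u
          · exact hIci u
      _ = M * M * (ENNReal.ofReal (u - r) * ENNReal.ofReal (R - u)) * ‖deriv g u‖ₑ := by ring
      _ ≤ M * M * (K * w u) * ‖deriv g u‖ₑ := by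
          refine mul_le_mul_left (mul_le_mul_right ?_ _) _
          by_cases hu : u ∈ Ioo r R
          · exact hK u hu
          -- Outside the interval one of the truncated distances is zero.
          · rw [mem_Ioo, not_and_or, not_lt, not_lt] at hu
            rcases hu with hu | hu
            · simp [ENNReal.ofReal_of_nonpos (sub_nonpos.2 hu)]
            · simp [ENNReal.ofReal_of_nonpos (sub_nonpos.2 hu)]
      _ = _ := by simp only [Pi.mul_apply]; ring
  calc ∫⁻ s, ∫⁻ t, ‖g s - g t‖ₑ ∂l ∂l
      ≤ ∫⁻ s, ∫⁻ t, ((∫⁻ u, N s t u) + ∫⁻ u, N t s u) ∂l ∂l :=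
        lintegral_mono_ae (hae.mono fun s hs ↦ lintegral_mono_ae (hae.mono fun t ht ↦
          hle' s hs t ht))
    _ = (∫⁻ s, ∫⁻ t, ∫⁻ u, N s t u ∂volume ∂l ∂l) +
          ∫⁻ s, ∫⁻ t, ∫⁻ u, N t s u ∂volume ∂l ∂l := by
        rw [← lintegral_add_left hNm.lintegral_prod_right']
        refine lintegral_congr fun s ↦ ?_
        exact lintegral_add_left (hNm.comp (measurable_prodMk_left (x := s))) _
    _ = 2 * ∫⁻ s, ∫⁻ t, ∫⁻ u, N s t u ∂volume ∂l ∂l := by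
        rw [lintegral_lintegral_swap (f := fun s t ↦ ∫⁻ u, N t s u)
          (hNm.comp measurable_swap).aemeasurable, two_mul]
    _ ≤ _ := by
        rw [mul_assoc]
        gcongr

end RadialPoincare

/-! ### Tensorisation over radius and angle. -/

section AnnulusPoincare

open Module ENNReal

variable {E : Type*} [NormedAddCommGroup E] [InnerProductSpace ℝ E] [FiniteDimensional ℝ E]
  [MeasurableSpace E] [BorelSpace E]

/-- The two-point `L¹` Poincaré inequality on an annulus in polar coordinates. -/
theorem exists_lintegral_polar_enorm_sub_le (hE : 2 ≤ finrank ℝ E) (μ : Measure E)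
    [μ.IsAddHaarMeasure] {r R : ℝ} (hr : 0 ≤ r) {w : ℝ → ℝ≥0∞} (hw : Measurable w)
    (hw0 : ∀ u ∉ Ioo r R, w u = 0) {M K : ℝ≥0∞} (hMtop : M ≠ ⊤) (hKtop : K ≠ ⊤)
    (hM : ∀ u, w u ≤ M)
    (hK : ∀ u ∈ Ioo r R, ENNReal.ofReal (u - r) * ENNReal.ofReal (R - u) ≤ K * w u) :
    ∃ C : ℝ≥0∞, C ≠ ⊤ ∧ ∀ f : E → ℝ, Measurable f → ContDiffOn ℝ 1 f (ball 0 R) →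
      ∫⁻ θ, ∫⁻ s, ∫⁻ φ, ∫⁻ t, ‖f (s • (θ : E)) - f (t • (φ : E))‖ₑ
          ∂volume.withDensity w ∂μ.toSphere ∂volume.withDensity w ∂μ.toSphere ≤
        C * ∫⁻ θ, ∫⁻ t, ‖fderiv ℝ f (t • (θ : E))‖ₑ ∂volume.withDensity w ∂μ.toSphere := by
  obtain ⟨K', hK'top, hK'⟩ := exists_lintegral_toSphere_enorm_sub_le hE μ R
  set l : Measure ℝ := volume.withDensity w with hl
  set σ := μ.toSphere with hσ
  have hSF : SFinite l := by rw [hl]; infer_instance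
  have hae : ∀ᵐ s ∂l, s ∈ Ioo r R := by
    rw [ae_withDensity_iff hw]
    exact .of_forall fun u hu ↦ by_contra fun h ↦ hu (hw0 u h)
  have hltop : l univ ≠ ⊤ := by
    rw [hl, withDensity_apply _ .univ, Measure.restrict_univ]
    have : ∫⁻ u, w u ≤ ∫⁻ u, (Ioo r R).indicator (fun _ ↦ M) u := lintegral_mono fun u ↦ by
      by_cases hu : u ∈ Ioo r R
      · simpa [indicator, hu] using hM u
      · simp [hw0 u hu]
    refine (this.trans_lt ?_).ne
    rw [lintegral_indicator_const measurableSet_Ioo]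
    exact ENNReal.mul_lt_top hMtop.lt_top (by simp)
  -- The radial increment does not involve `φ` and the angular one does not involve `s`; integrating
  -- these idle variables yields the total masses.
  refine ⟨σ univ * (2 * (M * M * K)) + l univ * K', ?_, fun f hfm hf ↦ ?_⟩
  · have := measure_ne_top σ univ
    finiteness
  have hdf : Measurable (fderiv ℝ f) := measurable_fderiv ℝ f
  let D : sphere (0 : E) 1 → ℝ → ℝ≥0∞ := fun θ t ↦ ‖fderiv ℝ f (t • (θ : E))‖ₑ
  have hD : Measurable fun p : sphere (0 : E) 1 × ℝ ↦ D p.1 p.2 := by fun_prop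
  let U : sphere (0 : E) 1 → ℝ → ℝ → ℝ≥0∞ := fun θ s t ↦
    ‖f (s • (θ : E)) - f (t • (θ : E))‖ₑ
  let V : sphere (0 : E) 1 → sphere (0 : E) 1 → ℝ → ℝ≥0∞ := fun θ φ t ↦
    ‖f (t • (θ : E)) - f (t • (φ : E))‖ₑ
  have hU : Measurable fun q : (sphere (0 : E) 1 × ℝ) × ℝ ↦ U q.1.1 q.1.2 q.2 := by fun_prop
  have hV : Measurable fun q : (sphere (0 : E) 1 × sphere (0 : E) 1) × ℝ ↦
    V q.1.1 q.1.2 q.2 := by fun_prop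
  have hUt : Measurable fun p : sphere (0 : E) 1 × ℝ ↦ ∫⁻ t, U p.1 p.2 t ∂l :=
    hU.lintegral_prod_right'
  have hVt : Measurable fun p : sphere (0 : E) 1 × sphere (0 : E) 1 ↦ ∫⁻ t, V p.1 p.2 t ∂l :=
    hV.lintegral_prod_right'
  have hradial : ∀ θ : sphere (0 : E) 1,
      ∫⁻ s, ∫⁻ t, U θ s t ∂l ∂l ≤ 2 * (M * M * K) * ∫⁻ t, D θ t ∂l := by
    intro θ
    have hmem : ∀ u ∈ Ioo r R, u • (θ : E) ∈ ball (0 : E) R := fun u hu ↦ by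
      simpa [norm_smul, abs_of_nonneg (hr.trans hu.1.le)] using hu.2
    have hgc : ContDiffOn ℝ 1 (fun u : ℝ ↦ f (u • (θ : E))) (Ioo r R) :=
      hf.comp (by fun_prop : ContDiff ℝ 1 fun u : ℝ ↦ u • (θ : E)).contDiffOn hmem
    refine (lintegral_enorm_sub_le_of_weight hw hw0 hM hK hgc).trans ?_
    gcongr 2 * (M * M * K) * ?_
    refine lintegral_mono_ae (hae.mono fun u hu ↦ ?_)
    have hd : DifferentiableAt ℝ f (u • (θ : E)) :=
      (hf.differentiableOn one_ne_zero).differentiableAt (isOpen_ball.mem_nhds (hmem u hu))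
    have hga : HasDerivAt (fun u : ℝ ↦ f (u • (θ : E)))
        (fderiv ℝ f (u • (θ : E)) ((1 : ℝ) • (θ : E))) u :=
      hd.hasFDerivAt.comp_hasDerivAt u ((hasDerivAt_id u).smul_const (θ : E))
    rw [hga.deriv, one_smul]
    refine (ContinuousLinearMap.le_opENorm _ _).trans_eq ?_
    rw [← ofReal_norm (θ : E)]
    simp [D]
  have hangular : ∫⁻ θ, ∫⁻ φ, ∫⁻ t, V θ φ t ∂l ∂σ ∂σ ≤ K' * ∫⁻ θ, ∫⁻ t, D θ t ∂l ∂σ := by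
    rw [← lintegral_prod (fun p : sphere (0 : E) 1 × sphere (0 : E) 1 ↦ ∫⁻ t, V p.1 p.2 t ∂l)
      hVt.aemeasurable, lintegral_lintegral_swap hV.aemeasurable,
      lintegral_lintegral_swap (f := D) hD.aemeasurable,
      ← lintegral_const_mul _ hD.lintegral_prod_left']
    refine lintegral_mono_ae (hae.mono fun t ht ↦ ?_)
    rw [lintegral_prod (fun p : sphere (0 : E) 1 × sphere (0 : E) 1 ↦ V p.1 p.2 t)
      (hV.comp (measurable_prodMk_right (y := t))).aemeasurable]
    -- The spherical constant is uniform over radii below `R`, so it survives integration in `t`.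
    exact hK' f hfm hf t ⟨hr.trans_lt ht.1, ht.2⟩
  calc ∫⁻ θ, ∫⁻ s, ∫⁻ φ, ∫⁻ t, ‖f (s • (θ : E)) - f (t • (φ : E))‖ₑ ∂l ∂σ ∂l ∂σ
      ≤ ∫⁻ θ, ∫⁻ s, ∫⁻ φ, ∫⁻ t, (U θ s t + V θ φ t) ∂l ∂σ ∂l ∂σ := by
        gcongr with θ s φ t
        refine le_trans (le_of_eq ?_) (enorm_add_le _ _)
        rw [sub_add_sub_cancel]
    _ = ∫⁻ θ, (σ univ * (∫⁻ s, ∫⁻ t, U θ s t ∂l ∂l) +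
          l univ * ∫⁻ φ, ∫⁻ t, V θ φ t ∂l ∂σ) ∂σ := by
        refine lintegral_congr fun θ ↦ ?_
        have h1 : ∀ s, ∫⁻ φ, ∫⁻ t, (U θ s t + V θ φ t) ∂l ∂σ =
            σ univ * (∫⁻ t, U θ s t ∂l) + ∫⁻ φ, ∫⁻ t, V θ φ t ∂l ∂σ := fun s ↦ by
          have h2 : ∀ φ, ∫⁻ t, (U θ s t + V θ φ t) ∂l =
              (∫⁻ t, U θ s t ∂l) + ∫⁻ t, V θ φ t ∂l := fun φ ↦
            lintegral_add_left (hU.comp (measurable_prodMk_left (x := (θ, s)))) _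
          simp_rw [h2]
          rw [lintegral_add_left measurable_const, lintegral_const, mul_comm]
        simp_rw [h1]
        rw [lintegral_add_right _ measurable_const, lintegral_const, mul_comm (l univ),
          lintegral_const_mul _ (f := fun s ↦ ∫⁻ t, U θ s t ∂l)
            (hUt.comp (measurable_prodMk_left (x := θ)))]
    _ = σ univ * (∫⁻ θ, ∫⁻ s, ∫⁻ t, U θ s t ∂l ∂l ∂σ) +
          l univ * ∫⁻ θ, ∫⁻ φ, ∫⁻ t, V θ φ t ∂l ∂σ ∂σ := by
        rw [lintegral_add_left (hUt.lintegral_prod_right'.const_mul _),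
          lintegral_const_mul _ hUt.lintegral_prod_right',
          lintegral_const_mul _ hVt.lintegral_prod_right']
    _ ≤ σ univ * (∫⁻ θ, 2 * (M * M * K) * ∫⁻ t, D θ t ∂l ∂σ) +
          l univ * (K' * ∫⁻ θ, ∫⁻ t, D θ t ∂l ∂σ) := by
        gcongr with θ
        exact hradial θ
    _ = _ := by
        rw [lintegral_const_mul _ hD.lintegral_prod_right']
        ring

end AnnulusPoincare

theorem ContinuousOn.measurable_indicator {α β : Type*} [TopologicalSpace α] [MeasurableSpace α]
    [OpensMeasurableSpace α] [TopologicalSpace β] [MeasurableSpace β] [BorelSpace β] [Zero β]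
    {f : α → β} {s : Set α} (hf : ContinuousOn f s) (hs : MeasurableSet s) :
    Measurable (s.indicator f) := by
  classical
  rw [← piecewise_eq_indicator]
  exact hf.measurable_piecewise continuousOn_const hs

/-! ### Concave profiles. -/

section ConcaveDensity

/-- A nonnegative concave function lies above the tent with apex `(m, ρ m)` and zeros at `r` and
`R`. On each side of `m`, the remaining distances are bounded by `R - r`. -/
theorem ConcaveOn.mul_sub_mul_sub_le {r R m u : ℝ} {ρ : ℝ → ℝ} (hconc : ConcaveOn ℝ (Icc r R) ρ)
    (hρ : ∀ t ∈ Icc r R, 0 ≤ ρ t) (hm : m ∈ Ioo r R) (hu : u ∈ Icc r R) :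
    (u - r) * (R - u) * ρ m ≤ (R - r) ^ 2 * ρ u := by
  have hrR : r < R := hm.1.trans hm.2
  have hr : r ∈ Icc r R := ⟨le_rfl, hrR.le⟩
  have hR : R ∈ Icc r R := ⟨hrR.le, le_rfl⟩
  have hmI : m ∈ Icc r R := ⟨hm.1.le, hm.2.le⟩
  have hm0 := hρ m hmI
  have hu0 := hρ u hu
  have h1 : 0 ≤ u - r := sub_nonneg.2 hu.1
  have h2 : 0 ≤ R - u := sub_nonneg.2 hu.2
  rcases le_total u m with h | h
  · have hd : 0 < m - r := sub_pos.2 hm.1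
    have key := hconc.2 hr hmI
      (div_nonneg (sub_nonneg.2 h) hd.le : 0 ≤ (m - u) / (m - r))
      (div_nonneg h1 hd.le : 0 ≤ (u - r) / (m - r)) (by field_simp; ring)
    have e : ((m - u) / (m - r)) • r + ((u - r) / (m - r)) • m = u := by
      simp only [smul_eq_mul]; field_simp; ring
    rw [e] at key
    simp only [smul_eq_mul] at key
    have key2 : (u - r) / (m - r) * ρ m ≤ ρ u :=
      le_trans (le_add_of_nonneg_left
        (mul_nonneg (div_nonneg (sub_nonneg.2 h) hd.le) (hρ r hr))) key
    rw [div_mul_eq_mul_div, div_le_iff₀ hd] at key2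
    calc (u - r) * (R - u) * ρ m = (R - u) * ((u - r) * ρ m) := by ring
      _ ≤ (R - r) * (ρ u * (m - r)) :=
        mul_le_mul (by linarith) key2 (mul_nonneg h1 hm0) (by linarith)
      _ ≤ (R - r) * (ρ u * (R - r)) := by
        have : 0 ≤ R - r := by linarith
        gcongr
        exact hm.2.le
      _ = _ := by ring
  · have hd : 0 < R - m := sub_pos.2 hm.2
    have key := hconc.2 hmI hR
      (div_nonneg h2 hd.le : 0 ≤ (R - u) / (R - m))
      (div_nonneg (sub_nonneg.2 h) hd.le : 0 ≤ (u - m) / (R - m)) (by field_simp; ring)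
    have e : ((R - u) / (R - m)) • m + ((u - m) / (R - m)) • R = u := by
      simp only [smul_eq_mul]; field_simp; ring
    rw [e] at key
    simp only [smul_eq_mul] at key
    have key2 : (R - u) / (R - m) * ρ m ≤ ρ u :=
      le_trans (le_add_of_nonneg_right
        (mul_nonneg (div_nonneg (sub_nonneg.2 h) hd.le) (hρ R hR))) key
    rw [div_mul_eq_mul_div, div_le_iff₀ hd] at key2
    calc (u - r) * (R - u) * ρ m = (u - r) * ((R - u) * ρ m) := by ring
      _ ≤ (R - r) * (ρ u * (R - m)) :=
        mul_le_mul (by linarith [hu.2]) key2 (mul_nonneg h2 hm0) (by linarith)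
      _ ≤ (R - r) * (ρ u * (R - r)) := by
        have : 0 ≤ R - r := by linarith
        gcongr
        exact hm.1.le
      _ = _ := by ring

theorem lintegral_indicator_Ioo_eq_one {r R : ℝ} (hr : 0 < r) {ρbar : ℝ → ℝ}
    (hρ : IsContinuousProbabilityDensity (Icc 0 R) ρbar) (hzero : ∀ t ∈ Icc 0 r, ρbar t = 0) :
    ∫⁻ t, (Ioo r R).indicator (fun t ↦ ENNReal.ofReal (ρbar t)) t = 1 := by
  have hint_on : IntegrableOn ρbar (Icc 0 R) := hρ.continuousOn.integrableOn_compact isCompact_Icc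
  have h := ofReal_integral_eq_lintegral_ofReal hint_on
    ((ae_restrict_mem measurableSet_Icc).mono hρ.nonneg)
  rw [hρ.integral_eq_one, ENNReal.ofReal_one, ← lintegral_indicator measurableSet_Icc] at h
  rw [h]
  refine lintegral_congr_ae ?_
  filter_upwards [Measure.ae_ne volume R] with t ht
  by_cases htr : t ≤ r
  · by_cases ht0 : 0 ≤ t
    · simp [indicator, htr.not_gt, hzero t ⟨ht0, htr⟩]
    · simp [indicator, htr.not_gt, ht0]
  · have h0 : 0 ≤ t := hr.le.trans (not_le.1 htr).le
    simp [indicator, not_le.1 htr, h0, lt_iff_le_and_ne, ht]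

theorem exists_mem_Ioo_pos {r R : ℝ} (hr : 0 < r) {ρbar : ℝ → ℝ}
    (hρ : IsContinuousProbabilityDensity (Icc 0 R) ρbar) (hzero : ∀ t ∈ Icc 0 r, ρbar t = 0) :
    ∃ m ∈ Ioo r R, 0 < ρbar m := by
  by_contra! h
  have h1 := lintegral_indicator_Ioo_eq_one hr hρ hzero
  have h2 : ∀ t, (Ioo r R).indicator (fun t ↦ ENNReal.ofReal (ρbar t)) t = 0 := fun t ↦
    indicator_apply_eq_zero.2 fun ht ↦ ENNReal.ofReal_of_nonpos (h t ht)
  simp [h2] at h1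

end ConcaveDensity

/-! ### The weighted norm on the open ball. -/

section WeightedNorm

variable {d : ℕ} {F : Type*} [NormedAddCommGroup F]

/-- The weighted norm as a lower Lebesgue integral over the open ball. -/
theorem ofReal_weightedL1Norm_closedBall [NeZero d] {R : ℝ}
    {ρ : EuclideanSpace ℝ (Fin d) → ℝ} (hρ : ContinuousOn ρ (closedBall 0 R))
    (hρ0 : ∀ x ∈ closedBall (0 : EuclideanSpace ℝ (Fin d)) R, 0 ≤ ρ x)
    {h : EuclideanSpace ℝ (Fin d) → F} (hh : ContinuousOn h (closedBall 0 R)) :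
    ENNReal.ofReal (weightedL1Norm (closedBall 0 R) ρ h) =
      ∫⁻ x in ball 0 R, ‖h x‖ₑ * ENNReal.ofReal (ρ x) := by
  have hint_on : IntegrableOn (fun x ↦ ‖h x‖ * ρ x) (closedBall 0 R) :=
    (hh.norm.mul hρ).integrableOn_compact (isCompact_closedBall _ _)
  -- The boundary sphere is null. Inside it, the gradient relative to the closed ball is the
  -- ordinary one.
  have hball : (ball (0 : EuclideanSpace ℝ (Fin d)) R : Set _) =ᵐ[volume] closedBall 0 R := by
    rw [← ball_union_sphere]
    exact (union_ae_eq_left_of_ae_eq_empty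
      (ae_eq_empty.2 (Measure.addHaar_sphere volume _ _))).symm
  rw [weightedL1Norm, ofReal_integral_eq_lintegral_ofReal hint_on
    ((ae_restrict_mem measurableSet_closedBall).mono fun x hx ↦
      mul_nonneg (norm_nonneg _) (hρ0 x hx)), ← Measure.restrict_congr_set hball]
  refine lintegral_congr fun x ↦ ?_
  rw [ENNReal.ofReal_mul (norm_nonneg _), ofReal_norm]

end WeightedNorm

/-! ### The radial density and its Poincaré–Wirtinger inequality. -/

section RadialDensity

open ENNReal

variable {d : ℕ} {r R : ℝ} {ρbar : ℝ → ℝ}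

theorem unitSphereVolume_pos (hd : 0 < d) : 0 < unitSphereVolume d := by
  have : NeZero d := ⟨hd.ne'⟩
  rw [unitSphereVolume, Measure.toSphere_real_apply_univ, finrank_euclideanSpace_fin]
  have h := measure_ball_pos (volume : Measure (EuclideanSpace ℝ (Fin d))) 0 one_pos
  exact mul_pos (Nat.cast_pos.2 hd) (ENNReal.toReal_pos h.ne' measure_ball_lt_top.ne)

/-- The origin is the only possible singularity, and the profile vanishes on `[0, r]`, hence the
density vanishes near the origin. -/
theorem continuousOn_radialDensity (hd : 0 < d) (hr : 0 < r)
    (hρ : ContinuousOn ρbar (Icc 0 R)) (hzero : ∀ t ∈ Icc 0 r, ρbar t = 0) :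
    ContinuousOn (radialDensity d ρbar) (closedBall 0 R) := by
  intro x hx
  by_cases hx0 : x = 0
  · subst hx0
    refine ContinuousAt.continuousWithinAt ?_
    refine (continuousAt_const (y := (0 : ℝ))).congr ?_
    filter_upwards [ball_mem_nhds (0 : EuclideanSpace ℝ (Fin d)) hr] with y hy
    rw [mem_ball_zero_iff] at hy
    simp [radialDensity, hzero _ ⟨norm_nonneg y, hy.le⟩]
  · have hnum : ContinuousWithinAt (fun y : EuclideanSpace ℝ (Fin d) ↦ ρbar ‖y‖)
        (closedBall 0 R) x :=
      (hρ.comp continuous_norm.continuousOn fun y hy ↦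
        ⟨norm_nonneg y, mem_closedBall_zero_iff.1 hy⟩) x hx
    refine hnum.div (Continuous.continuousWithinAt (by fun_prop)) ?_
    have := norm_ne_zero_iff.2 hx0
    have := (unitSphereVolume_pos hd).ne'
    positivity

theorem radialDensity_nonneg (hρ : ∀ t ∈ Icc 0 R, 0 ≤ ρbar t) :
    ∀ x ∈ closedBall (0 : EuclideanSpace ℝ (Fin d)) R, 0 ≤ radialDensity d ρbar x := fun x hx ↦
  div_nonneg (hρ _ ⟨norm_nonneg x, mem_closedBall_zero_iff.1 hx⟩)
    (mul_nonneg (pow_nonneg (norm_nonneg x) _) measureReal_nonneg)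

/-- Integration against a radial density in polar coordinates. -/
theorem lintegral_mul_radialDensity (hd : 0 < d) (hr : 0 < r)
    (hρ : ContinuousOn ρbar (Icc 0 R)) (hzero : ∀ t ∈ Icc 0 r, ρbar t = 0)
    {F : EuclideanSpace ℝ (Fin d) → ℝ≥0∞} (hF : Measurable F) :
    ∫⁻ x in ball 0 R, F x * ENNReal.ofReal (radialDensity d ρbar x) =
      ENNReal.ofReal (unitSphereVolume d)⁻¹ * ∫⁻ θ, ∫⁻ t, F (t • (θ : EuclideanSpace ℝ (Fin d)))
        ∂volume.withDensity ((Ioo r R).indicator fun t ↦ ENNReal.ofReal (ρbar t))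
        ∂(volume : Measure (EuclideanSpace ℝ (Fin d))).toSphere := by
  have : NeZero d := ⟨hd.ne'⟩
  have hω := unitSphereVolume_pos hd
  have hwm : Measurable ((Ioo r R).indicator fun t ↦ ENNReal.ofReal (ρbar t)) := by
    refine ContinuousOn.measurable_indicator ?_ measurableSet_Ioo
    exact ENNReal.continuous_ofReal.comp_continuousOn
      (hρ.mono fun t ht ↦ ⟨hr.le.trans ht.1.le, ht.2.le⟩)
  have hρm : Measurable ((ball (0 : EuclideanSpace ℝ (Fin d)) R).indicator
      fun x ↦ ENNReal.ofReal (radialDensity d ρbar x)) := by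
    refine ContinuousOn.measurable_indicator ?_ measurableSet_ball
    exact ENNReal.continuous_ofReal.comp_continuousOn
      ((continuousOn_radialDensity hd hr hρ hzero).mono ball_subset_closedBall)
  have hcongr : ∀ x, (ball (0 : EuclideanSpace ℝ (Fin d)) R).indicator
      (fun x ↦ F x * ENNReal.ofReal (radialDensity d ρbar x)) x =
      F x * (ball (0 : EuclideanSpace ℝ (Fin d)) R).indicator
        (fun x ↦ ENNReal.ofReal (radialDensity d ρbar x)) x := fun x ↦
    indicator_mul_right _ F _
  have hFθ : Measurable fun p : sphere (0 : EuclideanSpace ℝ (Fin d)) 1 × ℝ ↦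
      F (p.2 • (p.1 : EuclideanSpace ℝ (Fin d))) := by fun_prop
  rw [← lintegral_indicator measurableSet_ball, lintegral_congr hcongr,
    lintegral_eq_lintegral_toSphere volume (by fun_prop), finrank_euclideanSpace_fin,
    ← lintegral_const_mul _ hFθ.lintegral_prod_right']
  refine lintegral_congr fun θ ↦ ?_
  have hFt : Measurable fun t : ℝ ↦ F (t • (θ : EuclideanSpace ℝ (Fin d))) := by fun_prop
  rw [lintegral_withDensity_eq_lintegral_mul _ hwm hFt,
    ← lintegral_const_mul _ (hwm.mul hFt), ← lintegral_indicator measurableSet_Ioi]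
  refine lintegral_congr fun t ↦ ?_
  by_cases ht : 0 < t
  swap
  · simp [indicator, ht, show ¬ r < t from fun h ↦ ht (hr.trans h)]
  have hnorm : ‖t • (θ : EuclideanSpace ℝ (Fin d))‖ = t := by simp [norm_smul, abs_of_pos ht]
  by_cases htR : t < R
  swap
  · simp [indicator, norm_smul, abs_of_pos ht, htR]
  have hmem : t • (θ : EuclideanSpace ℝ (Fin d)) ∈ ball (0 : EuclideanSpace ℝ (Fin d)) R := by
    rwa [mem_ball_zero_iff, hnorm]
  rw [indicator_of_mem (mem_Ioi.2 ht), indicator_of_mem hmem, radialDensity, hnorm]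
  by_cases htr : t ≤ r
  · simp [indicator, htr.not_gt, hzero t ⟨ht.le, htr⟩]
  -- The Jacobian `t ^ (d - 1)` now cancels against the denominator of the density.
  rw [Pi.mul_apply, indicator_of_mem (mem_Ioo.2 ⟨not_le.1 htr, htR⟩), mul_left_comm,
    ← mul_assoc (ENNReal.ofReal _⁻¹), mul_comm _ (F _),
    ← ENNReal.ofReal_mul (pow_nonneg ht.le _), ← ENNReal.ofReal_mul (inv_nonneg.2 hω.le)]
  congr 2
  field_simp

theorem isContinuousProbabilityDensity_radialDensity (hd : 0 < d) (hr : 0 < r)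
    (hρ : IsContinuousProbabilityDensity (Icc 0 R) ρbar) (hzero : ∀ t ∈ Icc 0 r, ρbar t = 0) :
    IsContinuousProbabilityDensity (closedBall 0 R) (radialDensity d ρbar) := by
  have : NeZero d := ⟨hd.ne'⟩
  have hω := unitSphereVolume_pos hd
  have hc := continuousOn_radialDensity hd hr hρ.continuousOn hzero
  have h0 := radialDensity_nonneg (d := d) hρ.nonneg
  refine ⟨hc, h0, ?_⟩
  have h1 := ofReal_weightedL1Norm_closedBall hc h0 (h := fun _ ↦ (1 : ℝ)) continuousOn_const
  simp only [enorm_one] at h1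
  rw [lintegral_mul_radialDensity hd hr hρ.continuousOn hzero (F := fun _ ↦ 1) measurable_const]
    at h1
  simp only [lintegral_one] at h1
  rw [withDensity_apply _ .univ, Measure.restrict_univ,
    lintegral_indicator_Ioo_eq_one hr hρ hzero, lintegral_one,
    ← ofReal_measureReal (measure_ne_top _ _), ← unitSphereVolume,
    ← ENNReal.ofReal_mul (inv_nonneg.2 hω.le), inv_mul_cancel₀ hω.ne', ENNReal.ofReal_one,
    ENNReal.ofReal_eq_one] at h1
  simpa [weightedL1Norm] using h1

theorem closure_support_radialDensity (hd : 0 < d) (hr : 0 < r) (hrR : r < R)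
    (hzero : ∀ t ∈ Icc 0 r, ρbar t = 0) (hpos : ∀ t ∈ Ioo r R, 0 < ρbar t) :
    closure {x ∈ closedBall (0 : EuclideanSpace ℝ (Fin d)) R | radialDensity d ρbar x ≠ 0} =
      {x | r ≤ ‖x‖ ∧ ‖x‖ ≤ R} := by
  apply Subset.antisymm
  · refine closure_minimal ?_ ((isClosed_le continuous_const continuous_norm).inter
      (isClosed_le continuous_norm continuous_const))
    rintro x ⟨hx, hne⟩
    refine ⟨?_, mem_closedBall_zero_iff.1 hx⟩
    by_contra! h
    exact hne (by simp [radialDensity, hzero _ ⟨norm_nonneg x, h.le⟩])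
  · rintro x ⟨hx1, hx2⟩
    have hx0 : 0 < ‖x‖ := hr.trans_le hx1
    have hcl : ‖x‖ ∈ closure (Ioo r R) := by
      rw [closure_Ioo hrR.ne]
      exact ⟨hx1, hx2⟩
    -- Move along the ray through `x`: the point of norm `t` on it has nonzero density for `t` in
    -- the open interval, and `t = ‖x‖` is a limit of such values.
    have h := map_mem_closure (f := fun t : ℝ ↦ (t * ‖x‖⁻¹) • x) (by fun_prop) hcl
      (t := {x ∈ closedBall (0 : EuclideanSpace ℝ (Fin d)) R | radialDensity d ρbar x ≠ 0}) ?_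
    · simpa [hx0.ne'] using h
    intro t ht
    have ht0 : 0 < t := hr.trans ht.1
    have hn : ‖(t * ‖x‖⁻¹) • x‖ = t := by
      rw [norm_smul, Real.norm_of_nonneg (by positivity), inv_mul_cancel_right₀ hx0.ne']
    refine ⟨by rw [mem_closedBall_zero_iff, hn]; exact ht.2.le, ?_⟩
    rw [radialDensity, hn]
    have := hpos t ht
    have := unitSphereVolume_pos hd
    positivity

/-- The radial density attached to a concave profile on an annulus satisfies a weighted `L¹`
Poincaré–Wirtinger inequality. -/
theorem exists_satisfiesPoincareWirtinger_radialDensity (hd : 2 ≤ d) (hr : 0 < r) (hrR : r < R)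
    (hρ : IsContinuousProbabilityDensity (Icc 0 R) ρbar) (hzero : ∀ t ∈ Icc 0 r, ρbar t = 0)
    (hconc : ConcaveOn ℝ (Icc r R) ρbar) :
    ∃ C : ℝ, SatisfiesPoincareWirtinger (closedBall 0 R) (radialDensity d ρbar) C := by
  have hd0 : 0 < d := by omega
  have : NeZero d := ⟨hd0.ne'⟩
  have hdens := isContinuousProbabilityDensity_radialDensity hd0 hr hρ hzero
  obtain ⟨m, hm, hm0⟩ := exists_mem_Ioo_pos hr hρ hzero
  obtain ⟨M, hM⟩ := isCompact_Icc.exists_bound_of_continuousOn hρ.continuousOn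
  have hsub : ∀ t ∈ Icc r R, t ∈ Icc 0 R := fun t ht ↦ ⟨hr.le.trans ht.1, ht.2⟩
  let w : ℝ → ℝ≥0∞ := (Ioo r R).indicator fun t ↦ ENNReal.ofReal (ρbar t)
  have hwm : Measurable w := by
    refine ContinuousOn.measurable_indicator ?_ measurableSet_Ioo
    exact ENNReal.continuous_ofReal.comp_continuousOn
      (hρ.continuousOn.mono fun t ht ↦ ⟨hr.le.trans ht.1.le, ht.2.le⟩)
  have hwM : ∀ u, w u ≤ ENNReal.ofReal M := fun u ↦ by
    refine indicator_apply_le' (fun hu ↦ ENNReal.ofReal_le_ofReal ?_) fun _ ↦ zero_le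
    exact (le_abs_self _).trans (hM u (hsub u ⟨hu.1.le, hu.2.le⟩))
  have hwK : ∀ u ∈ Ioo r R, ENNReal.ofReal (u - r) * ENNReal.ofReal (R - u) ≤
      ENNReal.ofReal ((R - r) ^ 2 / ρbar m) * w u := fun u hu ↦ by
    have h := hconc.mul_sub_mul_sub_le (fun t ht ↦ hρ.nonneg t (hsub t ht)) hm ⟨hu.1.le, hu.2.le⟩
    simp only [w, indicator_of_mem hu]
    rw [← ENNReal.ofReal_mul (sub_nonneg.2 hu.1.le), ← ENNReal.ofReal_mul (by positivity)]
    refine ENNReal.ofReal_le_ofReal ?_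
    rwa [div_mul_eq_mul_div, le_div_iff₀ hm0]
  obtain ⟨K, hKtop, hK⟩ := exists_lintegral_polar_enorm_sub_le
    (E := EuclideanSpace ℝ (Fin d)) (by rwa [finrank_euclideanSpace_fin]) volume hr.le hwm
    (fun u hu ↦ indicator_of_notMem hu _) ENNReal.ofReal_ne_top ENNReal.ofReal_ne_top hwM hwK
  let c := ENNReal.ofReal (unitSphereVolume d)⁻¹
  have hcK : c * K ≠ ⊤ := ENNReal.mul_ne_top ENNReal.ofReal_ne_top hKtop
  -- Adding 1 ensures a positive constant without showing that `c * K` is nonzero.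
  refine ⟨(c * K).toReal + 1, isCompact_closedBall _ _, hdens, by positivity, fun f hf ↦ ?_⟩
  have hu : UniqueDiffOn ℝ (closedBall (0 : EuclideanSpace ℝ (Fin d)) R) :=
    uniqueDiffOn_convex (convex_closedBall _ _)
      ⟨0, ball_subset_interior_closedBall (mem_ball_self (hr.trans hrR))⟩
  have hgrad : ContinuousOn (fun x ↦ gradientWithin f (closedBall 0 R) x) (closedBall 0 R) :=
    (LinearIsometryEquiv.continuous _).comp_continuousOn
      (hf.continuousOn_fderivWithin hu le_rfl)
  -- Nothing is known about `f` outside the closed ball; cutting it off makes it globally measurable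
  -- without changing it on the open ball.
  let f₀ : EuclideanSpace ℝ (Fin d) → ℝ := (ball 0 R).indicator f
  have hf₀eq : EqOn f₀ f (ball 0 R) := fun x hx ↦ indicator_of_mem hx f
  have hf₀ : ContDiffOn ℝ 1 f₀ (ball 0 R) := (hf.mono ball_subset_closedBall).congr hf₀eq
  have hf₀m : Measurable f₀ :=
    (hf.continuousOn.mono ball_subset_closedBall).measurable_indicator measurableSet_ball
  have hdf₀ : Measurable (fderiv ℝ f₀) := measurable_fderiv ℝ f₀
  have hgrad_eq : ∀ x ∈ ball (0 : EuclideanSpace ℝ (Fin d)) R,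
      ‖gradientWithin f (closedBall 0 R) x‖ₑ = ‖fderiv ℝ f₀ x‖ₑ := fun x hx ↦ by
    have h1 : fderiv ℝ f₀ x = fderiv ℝ f x :=
      (hf₀eq.eventuallyEq_of_mem (isOpen_ball.mem_nhds hx)).fderiv_eq
    rw [h1, ← fderivWithin_of_mem_nhds (closedBall_mem_nhds_of_mem hx), gradientWithin]
    exact (LinearIsometryEquiv.enorm_map _ _)
  have hmean : ∀ x, ‖f x - weightedMean (closedBall 0 R) (radialDensity d ρbar) f‖ₑ ≤
      ∫⁻ y in ball 0 R, ‖f x - f y‖ₑ * ENNReal.ofReal (radialDensity d ρbar y) := fun x ↦ by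
    rw [← ofReal_weightedL1Norm_closedBall hdens.continuousOn hdens.nonneg
      (h := fun y ↦ f x - f y) (continuousOn_const.sub hf.continuousOn), ← ofReal_norm]
    refine ENNReal.ofReal_le_ofReal ?_
    have hi1 : IntegrableOn (fun y ↦ f x * radialDensity d ρbar y) (closedBall 0 R) :=
      (continuousOn_const.mul hdens.continuousOn).integrableOn_compact (isCompact_closedBall _ _)
    have hi2 : IntegrableOn (fun y ↦ f y * radialDensity d ρbar y) (closedBall 0 R) :=
      (hf.continuousOn.mul hdens.continuousOn).integrableOn_compact (isCompact_closedBall _ _)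
    have he : f x - weightedMean (closedBall 0 R) (radialDensity d ρbar) f =
        ∫ y in closedBall 0 R, (f x - f y) * radialDensity d ρbar y := by
      simp_rw [sub_mul]
      rw [integral_sub hi1 hi2, integral_const_mul, hdens.integral_eq_one, mul_one, weightedMean]
    rw [he, weightedL1Norm]
    refine (norm_integral_le_integral_norm _).trans_eq ?_
    refine setIntegral_congr_fun measurableSet_closedBall fun y hy ↦ ?_
    simp only [norm_mul, Real.norm_of_nonneg (hdens.nonneg y hy)]
  let σ := (volume : Measure (EuclideanSpace ℝ (Fin d))).toSphere
  let l : Measure ℝ := volume.withDensity w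
  have hpolar : ∀ {F : EuclideanSpace ℝ (Fin d) → ℝ≥0∞}, Measurable F →
      ∫⁻ x in ball 0 R, F x * ENNReal.ofReal (radialDensity d ρbar x) =
        c * ∫⁻ θ, ∫⁻ t, F (t • (θ : EuclideanSpace ℝ (Fin d))) ∂l ∂σ := fun hF ↦
    lintegral_mul_radialDensity hd0 hr hρ.continuousOn hzero hF
  have hmain : ENNReal.ofReal (weightedL1Norm (closedBall 0 R) (radialDensity d ρbar)
      (fun x ↦ f x - weightedMean (closedBall 0 R) (radialDensity d ρbar) f)) ≤
      c * K * ENNReal.ofReal (weightedL1Norm (closedBall 0 R) (radialDensity d ρbar)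
        (fun x ↦ gradientWithin f (closedBall 0 R) x)) := by
    rw [ofReal_weightedL1Norm_closedBall hdens.continuousOn hdens.nonneg
      (h := fun x ↦ f x - weightedMean (closedBall 0 R) (radialDensity d ρbar) f)
      (hf.continuousOn.sub continuousOn_const),
      ofReal_weightedL1Norm_closedBall hdens.continuousOn hdens.nonneg hgrad]
    -- `c * J x` is the average of `|f x - f y|` over `y` in polar coordinates; the same formula is
    -- then applied to the variable `x`.
    let J : EuclideanSpace ℝ (Fin d) → ℝ≥0∞ := fun x ↦
      ∫⁻ φ, ∫⁻ t, ‖f₀ x - f₀ (t • (φ : EuclideanSpace ℝ (Fin d)))‖ₑ ∂l ∂σ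
    have hJ : Measurable J := by
      have h1 : Measurable fun q : (EuclideanSpace ℝ (Fin d) ×
          sphere (0 : EuclideanSpace ℝ (Fin d)) 1) × ℝ ↦
          ‖f₀ q.1.1 - f₀ (q.2 • (q.1.2 : EuclideanSpace ℝ (Fin d)))‖ₑ := by fun_prop
      exact (h1.lintegral_prod_right' (ν := l)).lintegral_prod_right' (ν := σ)
    calc ∫⁻ x in ball 0 R, ‖f x - weightedMean (closedBall 0 R) (radialDensity d ρbar) f‖ₑ *
          ENNReal.ofReal (radialDensity d ρbar x)
        ≤ ∫⁻ x in ball 0 R, (c * J x) * ENNReal.ofReal (radialDensity d ρbar x) := by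
          refine setLIntegral_mono' measurableSet_ball fun x hx ↦ ?_
          gcongr
          refine (hmean x).trans_eq (Eq.trans ?_
            (hpolar (F := fun y ↦ ‖f₀ x - f₀ y‖ₑ) (by fun_prop)))
          refine setLIntegral_congr_fun measurableSet_ball fun y hy ↦ ?_
          simp only [hf₀eq hx, hf₀eq hy]
      _ = c * (c * ∫⁻ θ, ∫⁻ s, J (s • (θ : EuclideanSpace ℝ (Fin d))) ∂l ∂σ) := by
          rw [← hpolar hJ, ← lintegral_const_mul' _ _ ENNReal.ofReal_ne_top]
          simp_rw [mul_assoc]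
          rfl
      _ ≤ c * (c * (K * ∫⁻ θ, ∫⁻ t,
            ‖fderiv ℝ f₀ (t • (θ : EuclideanSpace ℝ (Fin d)))‖ₑ ∂l ∂σ)) := by
          gcongr
          exact hK f₀ hf₀m hf₀
      _ = c * K * (c * ∫⁻ θ, ∫⁻ t,
            ‖fderiv ℝ f₀ (t • (θ : EuclideanSpace ℝ (Fin d)))‖ₑ ∂l ∂σ) := by ring
      _ = _ := by
          rw [← hpolar hdf₀.enorm]
          congr 1
          refine setLIntegral_congr_fun measurableSet_ball fun x hx ↦ ?_
          simp only [hgrad_eq x hx]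
  have hnn : 0 ≤ weightedL1Norm (closedBall 0 R) (radialDensity d ρbar)
      (fun x ↦ gradientWithin f (closedBall 0 R) x) :=
    setIntegral_nonneg measurableSet_closedBall fun x hx ↦
      mul_nonneg (norm_nonneg _) (hdens.nonneg x hx)
  have hreal : weightedL1Norm (closedBall 0 R) (radialDensity d ρbar)
      (fun x ↦ f x - weightedMean (closedBall 0 R) (radialDensity d ρbar) f) ≤
      (c * K).toReal * weightedL1Norm (closedBall 0 R) (radialDensity d ρbar)
        (fun x ↦ gradientWithin f (closedBall 0 R) x) := by
    rw [← ENNReal.ofReal_le_ofReal_iff (by positivity), ENNReal.ofReal_mul ENNReal.toReal_nonneg,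
      ENNReal.ofReal_toReal hcK]
    exact hmain
  linarith

end RadialDensity

theorem mainTheorem9 (d : ℕ) (hd : 2 ≤ d) (r R : ℝ) (hr : 0 < r) (hrR : r < R)
    (ρbar : ℝ → ℝ) (hρ : IsContinuousProbabilityDensity (Icc 0 R) ρbar)
    (hzero : ∀ t ∈ Icc 0 r, ρbar t = 0) (hconc : ConcaveOn ℝ (Icc r R) ρbar) :
    closure {x ∈ closedBall (0 : EuclideanSpace ℝ (Fin d)) R | radialDensity d ρbar x ≠ 0} =
        {x | r ≤ ‖x‖ ∧ ‖x‖ ≤ R} ∧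
      ∃ C : ℝ, SatisfiesPoincareWirtinger (closedBall 0 R) (radialDensity d ρbar) C := by
  refine ⟨closure_support_radialDensity (by omega) hr hrR hzero fun t ht ↦ ?_,
    exists_satisfiesPoincareWirtinger_radialDensity hd hr hrR hρ hzero hconc⟩
  obtain ⟨m, hm, hm0⟩ := exists_mem_Ioo_pos hr hρ hzero
  -- Positivity at the single point `m` spreads to the whole open interval by concavity.
  have h := hconc.mul_sub_mul_sub_le
    (fun t ht ↦ hρ.nonneg t ⟨hr.le.trans ht.1, ht.2⟩) hm ⟨ht.1.le, ht.2.le⟩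
  have h1 : 0 < (t - r) * (R - t) * ρbar m :=
    mul_pos (mul_pos (sub_pos.2 ht.1) (sub_pos.2 ht.2)) hm0
  exact pos_of_mul_pos_right (h1.trans_le h) (sq_nonneg _)
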